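/- Let $n$ be a positive integer and let $\mathbf{P}^1(\mathbf{F}_{2^n})=\mathbf{F}_{2^n}\cup\{\infty\}$. Define $\theta$ on $\mathbf{P}^1(\mathbf{F}_{2^n})$ by $\theta(0)=\theta(\infty)=\infty$ and $\theta(\alpha)=\alpha+\alpha^{-1}$ otherwise, and consider the directed graph with an edge $\alpha\to\theta(\alpha)$ for each $\alpha$. Let $\mathrm{Tr}_n(\alpha)=\sum_{i=0}^{n-1}\alpha^{2^i}$, let $$A_n=\{\alpha\in\mathbf{F}_{2^n}^*:\mathrm{Tr}_n(\alpha)=\mathrm{Tr}_n(\alpha^{-1})\}\cup\{0,\infty\},$$ and let $V_{A_n}$ be the set of the $x\in A_n$ that are periodic, i.e. $\theta^k(x)=x$ for some $k\geq 1$. For $x\in V_{A_n}$, the tree rooted in $x$ consists of $x$ and of all non-periodic $y$ such that $x$ is the first periodic element among $\theta(y),\theta^2(y),\dots$; the children of a vertex $v$ are the non-periodic $w$ with $\theta(w)=v$, the level of $y$ is the least $k\ge 0$ with $\theta^k(y)=x$, and the depth is the greatest level that occurs. Finally let $\omega=\frac{1+\sqrt{-7}}{2}$, $\pi_2=-1+\omega$,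 $\overline{\pi}_2$ its complex conjugate, and let $e_0$ be the exponent of the prime $\overline{\pi}_2$ in the factorization of $\pi_2^n-1$ in the ring $\mathbf{Z}[\omega]$. Then every $x\in V_{A_n}$ is the root of a reversed binary tree of depth $e_0$ (every edge points from child to parent and every vertex has at most two children), all of whose vertices lie in $A_n$, with the following properties. - If $x\neq\infty$, then for $0\le k\le e_0$ there are $\lceil 2^{k-1}\rceil$ vertices at level $k$. The root has exactly one child, and every vertex at a level $k$ with $1\le k<e_0$ has exactly two children. - If $x=\infty$, then for $0\le k\le e_0$ there are $\lceil 2^{k-2}\rceil$ vertices at level $k$. The root and the vertex at level $1$ have exactly one child each, and every vertex at a level $k$ with $2\le k<e_0$ has exactly two children. Moreover, $e_0=l+2$, where $2^l$ is the exact power of $2$ dividing $n$. -/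

import Mathlib

namespace KoblitzGraph

/-! ### The map `θ`, its graph and the set `A_n` -/

/-- The map `θ` on the projective line `F ∪ {∞}`: `θ 0 = θ ∞ = ∞` and `θ α = α + α⁻¹` otherwise. -/
noncomputable def theta {F : Type*} [Field F] : OnePoint F → OnePoint F
  | OnePoint.infty => OnePoint.infty
  | OnePoint.some a =>
    open Classical in if a = 0 then OnePoint.infty else OnePoint.some (a + a⁻¹)

/-- The directed graph of `θ`: one edge from each `α` to `θ α`. -/
def thetaGraph (F : Type*) [Field F] : Digraph (OnePoint F) where
  Adj a b := theta a = b

/-- The absolute trace `Tr_n α = ∑_{i < n} α ^ (2 ^ i)` of a field with `2 ^ n` elements. -/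
def absTrace {F : Type*} [Field F] (n : ℕ) (α : F) : F :=
  ∑ i ∈ Finset.range n, α ^ (2 ^ i)

/-- The set `A_n` of the nonzero `α` with `Tr_n α = Tr_n α⁻¹`, together with `0` and `∞`. -/
def setA (F : Type*) [Field F] (n : ℕ) : Set (OnePoint F) :=
  OnePoint.some '' {α : F | α ≠ 0 ∧ absTrace n α = absTrace n α⁻¹} ∪
    {OnePoint.some 0, OnePoint.infty}

/-- The set `V_{A_n}` of the elements of `A_n` that are periodic under `θ`. -/
def periodicA (F : Type*) [Field F] (n : ℕ) : Set (OnePoint F) :=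
  setA F n ∩ Function.periodicPts theta

/-! ### Reversed rooted trees in directed graphs -/

section Trees

variable {V : Type*}

/-- The children of `v` in the subgraph of `G` induced on `S` (edges point from child to parent). -/
def children (G : Digraph V) (S : Set V) (v : V) : Set V :=
  {w | w ∈ S ∧ v ∈ S ∧ G.Adj w v}

/-- Level `k` of the subgraph of `G` induced on `S`, seen from `r`: level `0` is `{r}` and
level `k + 1` consists of the children of the vertices of level `k`. -/
def level (G : Digraph V) (S : Set V) (r : V) : ℕ → Set V
  | 0 => {r}
  | k + 1 => {w | ∃ v ∈ level G S r k, w ∈ children G S v}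

/-- The subgraph of `G` induced on `S` is a reversed binary tree with root `r` and depth `d`:
no edge leaves the root, every other vertex has exactly one outgoing edge, every vertex
is joined to the root by a directed path, every vertex has at most two children, and `d`
is the greatest index of a nonempty level. -/
structure IsReversedBinaryTree (G : Digraph V) (S : Set V) (r : V) (d : ℕ) : Prop where
  root_mem : r ∈ S
  root_out : ∀ w ∈ S, ¬ G.Adj r w
  unique_out : ∀ v ∈ S, v ≠ r → ∃! w, w ∈ S ∧ G.Adj v w
  reaches_root : ∀ v ∈ S, ∃ k, v ∈ level G S r k
  binary : ∀ v ∈ S, (children G S v).encard ≤ 2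
  depth : IsGreatest {k | (level G S r k).Nonempty} d

end Trees

/-! ### The trees entering the cycles of the graph of `θ` -/

/-- The graph of `θ` without the edges of its cycles, that is, without the edges that start at
a periodic vertex. -/
def treeGraph (F : Type*) [Field F] : Digraph (OnePoint F) where
  Adj a b := (thetaGraph F).Adj a b ∧ a ∉ Function.periodicPts (theta (F := F))

/-- The vertices of the tree rooted in `x`: all vertices from which `x` can be reached without
using an edge of a cycle. For periodic `x` these are `x` and all the nonperiodic `y` for
which `x` is the first periodic element of the orbit `y, θ y, θ² y, …`. -/
def treeVertices {F : Type*} [Field F] (x : OnePoint F) : Set (OnePoint F) :=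
  {y | Relation.ReflTransGen (treeGraph F).Adj y x}

/-- The children of a vertex `v` in the tree rooted in `x`. -/
def treeChildren {F : Type*} [Field F] (x v : OnePoint F) : Set (OnePoint F) :=
  children (treeGraph F) (treeVertices x) v

/-- The level `k` of the tree rooted in `x`. -/
def treeLevel {F : Type*} [Field F] (x : OnePoint F) (k : ℕ) : Set (OnePoint F) :=
  level (treeGraph F) (treeVertices x) x k

/-! ### The exponent `e₀` -/

/-- The ring `ℤ[ω]` with `ω² = -2 + ω`, that is `ω = (1 + √-7) / 2`: the ring of integers
of `ℚ(√-7)`. -/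
abbrev R : Type := QuadraticAlgebra ℤ (-2) 1

/-- The Frobenius element `π₂ = -1 + ω = (-1 + √-7) / 2` of `ℤ[ω]`. -/
def pi2 : R := -1 + QuadraticAlgebra.omega

/-- The exponent `e₀` of the conjugate of `π₂` in the factorization of `π₂ ^ n - 1` into primes
of `ℤ[ω]` (here `star` is the conjugation). -/
noncomputable def e0 (n : ℕ) : ℕ := multiplicity (star pi2) (pi2 ^ n - 1)

end KoblitzGraph

/-!
For `n = 2 ^ l * m` with `m` odd, all the trees have depth `l + 2`; this is proved without counting
points.

*The graph on `A_n`.* A vertex `b ∉ {0, ∞}` has a preimage under `θ` iff `u ^ 2 + u = b⁻¹ ^ 2` is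
solvable, that is, iff `Tr b⁻¹ = 0` (`exists_theta_eq_some_iff`); if it has one preimage `a`, it has
exactly the two preimages `a` and `a⁻¹`. Hence the shape of the trees follows once it is known at
which levels the leaves lie.

*The tree rooted in `∞`.* It starts with `∞ ← 0 ← 1`, and the `j`-fold preimages of `1` generate the
field with `2 ^ 2 ^ j` elements and have trace `1` there (`absTrace_of_iterate_theta_eq_one`). So
over the field with `2 ^ n` elements their trace is `n / 2 ^ j`, and the leaves are the `l`-fold
preimages of `1`, at level `l + 2`.

*The other trees.* `A_n` is the set of the `x`-coordinates of the rational points of the Koblitz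
curve `y² + xy = x³ + 1`, including the point at infinity, and `x (2 P) = θ (x P) ^ 2`. As the
Frobenius map is bijective, `θ` is induced by an endomorphism `φ` of the finite group of rational
points (`xCoord_conjFrobenius`). In the group, the tree rooted in `∞` is the union of the kernels
of the iterates of `φ`: they stop growing at `φ^[l + 2]`, and the kernel of `φ^[l + 1]` lies in the
range of `φ`. Subtracting a periodic point, one finds that a point `P` lies in the range of `φ` iff
`φ^[l + 1] P` is periodic (`exists_eq_iff_iterate_mem_periodicPts`), and `φ^[l + 2] P` is
always periodic. So the leaves of every tree lie at level `l + 2`.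

*The exponent.* The conjugate of `π₂` is `-ω`, and `π₂ - 1 = ω ^ 2`. From the exponent `2` on,
squaring `x` raises the exponent of `ω` in `x - 1` by one, and odd powers leave it unchanged, so
that `e₀ = l + 2` (`e0_two_pow_mul_odd`).
-/

namespace KoblitzGraph

/-! ### The absolute trace in characteristic two -/

section Trace

variable {F : Type*} [Field F]

lemma absTrace_zero (m : ℕ) : absTrace m (0 : F) = 0 := by
  simp [absTrace]

lemma absTrace_add_index (m k : ℕ) (a : F) :
    absTrace (m + k) a = absTrace m a + absTrace k (a ^ 2 ^ m) := by
  simp only [absTrace, Finset.sum_range_add, pow_add, pow_mul]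

lemma absTrace_mul_index {m : ℕ} {a : F} (ha : a ^ 2 ^ m = a) (t : ℕ) :
    absTrace (m * t) a = t * absTrace m a := by
  induction t with
  | zero => simp [absTrace]
  | succ t ih =>
    have hfix : a ^ 2 ^ (m * t) = a := by
      clear ih
      induction t with
      | zero => simp
      | succ t iht => rw [mul_add, mul_one, pow_add, pow_mul, iht, ha]
    rw [mul_add, mul_one, absTrace_add_index, ih, hfix]
    push_cast
    ring

lemma pow_two_pow_card [Finite F] {n : ℕ} (hF : Nat.card F = 2 ^ n) (a : F) : a ^ 2 ^ n = a := by
  have := Fintype.ofFinite F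
  rw [← hF, Nat.card_eq_fintype_card, FiniteField.pow_card]

variable [CharP F 2]

lemma absTrace_add (m : ℕ) (a b : F) : absTrace m (a + b) = absTrace m a + absTrace m b := by
  simp only [absTrace, add_pow_char_pow, Finset.sum_add_distrib]

lemma absTrace_sq_add_self (m : ℕ) (u : F) : absTrace m (u ^ 2 + u) = u ^ 2 ^ m + u := by
  induction m with
  | zero => simp [absTrace, CharTwo.add_self_eq_zero]
  | succ m ih =>
    rw [absTrace_add_index, ih]
    simp only [absTrace, Finset.sum_range_one, pow_zero, pow_one, add_pow_char_pow]
    rw [← pow_mul, pow_succ, mul_comm 2]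
    linear_combination CharTwo.add_self_eq_zero (u ^ 2 ^ m)

lemma absTrace_sq {m : ℕ} {a : F} (ha : a ^ 2 ^ m = a) : absTrace m (a ^ 2) = absTrace m a := by
  rw [← CharTwo.add_eq_zero, ← absTrace_add, absTrace_sq_add_self, ha, CharTwo.add_self_eq_zero]

/-- The absolute trace as an additive homomorphism. -/
def absTraceHom (F : Type*) [Field F] [CharP F 2] (m : ℕ) : F →+ F where
  toFun := absTrace m
  map_zero' := absTrace_zero m
  map_add' := absTrace_add m

/-- The Artin–Schreier homomorphism `u ↦ u² + u`. -/
def artinSchreierHom (F : Type*) [Field F] [CharP F 2] : F →+ F where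
  toFun u := u ^ 2 + u
  map_zero' := by simp
  map_add' a b := by rw [add_pow_char]; ring

lemma card_ker_artinSchreierHom : Nat.card (artinSchreierHom F).ker = 2 := by
  have h : ((artinSchreierHom F).ker : Set F) = {0, 1} := by
    ext u
    have : u ^ 2 + u = u * (u + 1) := by ring
    simp [AddMonoidHom.mem_ker, artinSchreierHom, this, CharTwo.add_eq_zero]
  rw [← Set.ncard_pair (zero_ne_one (α := F)), ← h]
  rfl

open Polynomial in
lemma card_ker_absTraceHom_le {n : ℕ} (hn : 0 < n) :
    Nat.card (absTraceHom F n).ker ≤ 2 ^ (n - 1) := by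
  classical
  obtain ⟨m, rfl⟩ : ∃ m, n = m + 1 := ⟨n - 1, by omega⟩
  set p : F[X] := ∑ i ∈ Finset.range (m + 1), X ^ 2 ^ i with hp
  have hdeg : p.natDegree ≤ 2 ^ m := by
    refine natDegree_sum_le_of_forall_le _ _ fun i hi => ?_
    rw [natDegree_X_pow]
    exact Nat.pow_le_pow_right (by norm_num) (by simpa [Nat.lt_succ_iff] using hi)
  have hp0 : p ≠ 0 := by
    intro h0
    have h1 : p.coeff 1 = 1 := by
      rw [hp, finsetSum_coeff, Finset.sum_eq_single 0]
      · simp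
      · intro i _ hi
        rw [coeff_X_pow, if_neg]
        exact (Nat.one_lt_pow hi (by norm_num)).ne
      · simp
    simp [h0] at h1
  have hsub : ((absTraceHom F (m + 1)).ker : Set F) ⊆ p.roots.toFinset := by
    intro u hu
    have : absTrace (m + 1) u = 0 := hu
    simp only [Finset.mem_coe, Multiset.mem_toFinset, mem_roots hp0]
    simpa [hp, IsRoot, eval_finsetSum, absTrace] using this
  calc Nat.card (absTraceHom F (m + 1)).ker
      = ((absTraceHom F (m + 1)).ker : Set F).ncard := rfl
    _ ≤ (p.roots.toFinset : Set F).ncard := Set.ncard_le_ncard hsub (Finset.finite_toSet _)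
    _ ≤ 2 ^ m := by
      rw [Set.ncard_coe_finset]
      exact (Multiset.toFinset_card_le _).trans ((card_roots' p).trans hdeg)

/-- Additive Hilbert 90 over the field with two elements: the image of the Artin–Schreier map lies
in the kernel of the trace, and it is at least as large. -/
lemma exists_sq_add_self_eq [Finite F] {n : ℕ} (hn : 0 < n) (hF : Nat.card F = 2 ^ n) {a : F} :
    (∃ u, u ^ 2 + u = a) ↔ absTrace n a = 0 := by
  have hle : (artinSchreierHom F).range ≤ (absTraceHom F n).ker := by
    rintro _ ⟨u, rfl⟩
    change absTrace n (u ^ 2 + u) = 0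
    rw [absTrace_sq_add_self, pow_two_pow_card hF, CharTwo.add_self_eq_zero]
  have hcard : 2 ^ (n - 1) = Nat.card (artinSchreierHom F).range := by
    have h := AddSubgroup.card_mul_index (artinSchreierHom F).ker
    rw [AddSubgroup.index_ker, card_ker_artinSchreierHom, hF] at h
    obtain ⟨m, rfl⟩ : ∃ m, n = m + 1 := ⟨n - 1, by omega⟩
    rw [pow_succ] at h
    simp only [Nat.add_sub_cancel]
    omega
  have heq := AddSubgroup.eq_of_le_of_card_ge hle ((card_ker_absTraceHom_le hn).trans hcard.le)
  exact (SetLike.ext_iff.mp heq a)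

end Trace

/-! ### Preimages under `θ` and the trace -/

section Theta

variable {F : Type*} [Field F]

lemma theta_infty : theta (OnePoint.infty : OnePoint F) = OnePoint.infty := rfl

lemma theta_zero : theta (OnePoint.some (0 : F)) = OnePoint.infty := by
  simp [theta]

lemma theta_some {a : F} (ha : a ≠ 0) : theta (OnePoint.some a) = OnePoint.some (a + a⁻¹) := by
  simp [theta, ha]

lemma theta_eq_infty_iff {v : OnePoint F} :
    theta v = OnePoint.infty ↔ v = OnePoint.infty ∨ v = OnePoint.some 0 := by
  induction v using OnePoint.rec with
  | infty => simp [theta_infty]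
  | coe a =>
    rcases eq_or_ne a 0 with rfl | ha
    · simp [theta_zero]
    · simp [theta_some ha, ha]

lemma theta_eq_some_iff {v : OnePoint F} {b : F} :
    theta v = OnePoint.some b ↔ ∃ a : F, a ≠ 0 ∧ v = OnePoint.some a ∧ a + a⁻¹ = b := by
  induction v using OnePoint.rec with
  | infty => simp [theta_infty]
  | coe a =>
    rcases eq_or_ne a 0 with rfl | ha
    · simp [theta_zero]
    · simp [theta_some ha, ha]

lemma infty_mem_setA (n : ℕ) : OnePoint.infty ∈ setA F n := by
  simp [setA]

lemma some_mem_setA_iff {n : ℕ} {a : F} :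
    OnePoint.some a ∈ setA F n ↔ absTrace n a = absTrace n a⁻¹ := by
  rcases eq_or_ne a 0 with rfl | ha
  · simp [setA]
  · simp [setA, ha]

variable [CharP F 2]

lemma add_inv_eq_zero_iff {a : F} (ha : a ≠ 0) : a + a⁻¹ = 0 ↔ a = 1 := by
  have : a * (a + a⁻¹) = (a + 1) ^ 2 := by
    rw [CharTwo.add_sq]
    field_simp
  rw [← CharTwo.add_eq_zero (b := (1 : F)), ← sq_eq_zero_iff (a := a + 1), ← this, mul_eq_zero,
    or_iff_right ha]

lemma theta_eq_zero_iff {v : OnePoint F} : theta v = OnePoint.some 0 ↔ v = OnePoint.some 1 := by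
  rw [theta_eq_some_iff]
  constructor
  · rintro ⟨a, ha, rfl, h⟩
    rw [(add_inv_eq_zero_iff ha).mp h]
  · rintro rfl
    exact ⟨1, one_ne_zero, rfl, (add_inv_eq_zero_iff one_ne_zero).mpr rfl⟩

lemma add_inv_eq_add_inv_iff {a b : F} (ha : a ≠ 0) (hb : b ≠ 0) :
    a + a⁻¹ = b + b⁻¹ ↔ a = b ∨ a = b⁻¹ := by
  constructor
  · intro h
    have h1 : (a - b) * (a - b⁻¹) = 0 := by
      have h2 : a * (a + a⁻¹) = a * (b + b⁻¹) := by rw [h]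
      rw [mul_add, mul_inv_cancel₀ ha] at h2
      have h3 := CharTwo.add_self_eq_zero (1 : F)
      have h4 := mul_inv_cancel₀ hb
      linear_combination h2 + h4
    rcases mul_eq_zero.mp h1 with h1 | h1
    · exact Or.inl (sub_eq_zero.mp h1)
    · exact Or.inr (sub_eq_zero.mp h1)
  · rintro (rfl | rfl)
    · rfl
    · rw [inv_inv, add_comm]

/-- A solution `a` of `a + a⁻¹ = b` gives the solution `u = a / b` of `u ^ 2 + u = b⁻¹ ^ 2`. -/
lemma sq_add_self_of_add_inv {a b : F} (ha : a ≠ 0) (hb : b ≠ 0) (hab : a + a⁻¹ = b) :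
    (a * b⁻¹) ^ 2 + a * b⁻¹ = b⁻¹ ^ 2 := by
  have h1 : a * (a + a⁻¹) = a * b := by rw [hab]
  rw [mul_add, mul_inv_cancel₀ ha] at h1
  field_simp
  linear_combination a ^ 2 * CharTwo.add_self_eq_zero (1 : F) - h1

lemma exists_theta_eq_some_iff [Finite F] {n : ℕ} (hn : 0 < n) (hF : Nat.card F = 2 ^ n)
    {b : F} (hb : b ≠ 0) :
    (∃ v : OnePoint F, theta v = OnePoint.some b) ↔ absTrace n b⁻¹ = 0 := by
  rw [← absTrace_sq (pow_two_pow_card hF _), ← exists_sq_add_self_eq hn hF]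
  simp only [theta_eq_some_iff]
  constructor
  · rintro ⟨_, a, ha, rfl, hab⟩
    exact ⟨a * b⁻¹, sq_add_self_of_add_inv ha hb hab⟩
  · rintro ⟨u, hu⟩
    have hu0 : u ≠ 0 := by
      rintro rfl
      exact pow_ne_zero 2 (inv_ne_zero hb) (by simpa using hu.symm)
    have h1 : u * b * (u * b) + b * (u * b) = 1 := by
      have h2 : b ^ 2 * (u ^ 2 + u) = 1 := by rw [hu]; field_simp
      linear_combination h2
    refine ⟨_, u * b, mul_ne_zero hu0 hb, rfl, ?_⟩
    have h3 : (u * b)⁻¹ = u * b + b := by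
      refine inv_eq_of_mul_eq_one_right ?_
      linear_combination h1
    rw [h3, ← add_assoc, CharTwo.add_self_eq_zero, zero_add]

lemma mem_setA_of_theta_mem [Finite F] {n : ℕ} (hn : 0 < n) (hF : Nat.card F = 2 ^ n)
    {v : OnePoint F} (hv : theta v ∈ setA F n) : v ∈ setA F n := by
  induction v using OnePoint.rec with
  | infty => exact hv
  | coe a =>
    rcases eq_or_ne a 0 with rfl | ha
    · simp [some_mem_setA_iff]
    rw [some_mem_setA_iff, ← CharTwo.add_eq_zero, ← absTrace_add]
    rcases eq_or_ne (a + a⁻¹) 0 with h0 | h0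
    · rw [h0, absTrace_zero]
    · have h1 := (exists_theta_eq_some_iff hn hF h0).mp ⟨_, theta_some ha⟩
      rwa [theta_some ha, some_mem_setA_iff, h1] at hv

/-! ### The tree rooted in `∞` -/

/-- The `j`-fold preimages of `1` generate the field with `2 ^ 2 ^ j` elements. In the inductive
step, a solution `a` of `a + a⁻¹ = b` lies outside the field of `b` since `b⁻¹` has trace `1`
there, so its conjugate over that field is `a⁻¹`, and the trace of `a` is that of
`a + a⁻¹ = b`. -/
lemma absTrace_of_iterate_theta_eq_one {j : ℕ} {v : OnePoint F}
    (hv : theta^[j] v = OnePoint.some 1) :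
    ∃ a : F, v = OnePoint.some a ∧ a ^ 2 ^ 2 ^ j = a ∧
      absTrace (2 ^ j) a = 1 ∧ absTrace (2 ^ j) a⁻¹ = 1 := by
  induction j generalizing v with
  | zero => exact ⟨1, by simpa using hv, by simp, by simp [absTrace], by simp [absTrace]⟩
  | succ j ih =>
    obtain ⟨b, hb, hfix, htr, htr'⟩ := ih (v := theta v) (by rwa [← Function.iterate_succ_apply])
    obtain ⟨a, ha, rfl, hab⟩ := theta_eq_some_iff.mp hb
    have hb0 : b ≠ 0 := by
      rintro rfl
      simp [absTrace_zero] at htr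
    have hconj : a ^ 2 ^ 2 ^ j = a⁻¹ := by
      have h1 : a ^ 2 ^ 2 ^ j + (a ^ 2 ^ 2 ^ j)⁻¹ = a + a⁻¹ := by
        rw [← inv_pow, ← add_pow_char_pow, hab, hfix]
      rcases (add_inv_eq_add_inv_iff (pow_ne_zero _ ha) ha).mp h1 with h2 | h2
      · exfalso
        have h4 := absTrace_sq_add_self (2 ^ j) (a * b⁻¹)
        rw [sq_add_self_of_add_inv ha hb0 hab, absTrace_sq (by rw [inv_pow, hfix]), htr',
          mul_pow, h2, inv_pow, hfix, CharTwo.add_self_eq_zero] at h4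
        exact one_ne_zero h4
      · exact h2
    refine ⟨a, rfl, ?_, ?_, ?_⟩
    · rw [pow_succ 2 j, mul_two, pow_add, pow_mul, hconj, inv_pow, hconj, inv_inv]
    · rw [pow_succ 2 j, mul_two, absTrace_add_index, hconj, ← absTrace_add, hab, htr]
    · rw [pow_succ 2 j, mul_two, absTrace_add_index, inv_pow, hconj, inv_inv, ← absTrace_add,
        add_comm, hab, htr]

lemma exists_theta_eq_iff_of_iterate_eq_one [Finite F] {l t j : ℕ}
    (hF : Nat.card F = 2 ^ (2 ^ l * (2 * t + 1))) {v : OnePoint F}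
    (hv : theta^[j] v = OnePoint.some 1) (hj : j ≤ l) : (∃ w, theta w = v) ↔ j < l := by
  obtain ⟨a, rfl, hfix, htr, htr'⟩ := absTrace_of_iterate_theta_eq_one hv
  have ha : a ≠ 0 := by
    rintro rfl
    simp [absTrace_zero] at htr
  obtain ⟨d, rfl⟩ := Nat.exists_eq_add_of_le hj
  rw [exists_theta_eq_some_iff (by positivity) hF ha, pow_add, mul_assoc,
    absTrace_mul_index (by rw [inv_pow, hfix]), htr', mul_one]
  rw [CharP.cast_eq_zero_iff F 2]
  rcases d with _ | d
  · simp
  · simp only [lt_add_iff_pos_right, Nat.zero_lt_succ, iff_true]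
    exact (dvd_pow_self 2 d.succ_ne_zero).mul_right _

lemma eq_of_iterate_theta_eq_infty {m : ℕ} {v : OnePoint F} (hv : theta^[m] v = OnePoint.infty) :
    v = OnePoint.infty ∨ v = OnePoint.some 0 ∨
      ∃ j, j + 2 ≤ m ∧ theta^[j] v = OnePoint.some 1 := by
  induction m with
  | zero => exact Or.inl hv
  | succ m ih =>
    rw [Function.iterate_succ_apply', theta_eq_infty_iff] at hv
    rcases hv with hv | hv
    · rcases ih hv with h | h | ⟨j, hj, h⟩
      · exact Or.inl h
      · exact Or.inr (Or.inl h)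
      · exact Or.inr (Or.inr ⟨j, by omega, h⟩)
    · rcases m with _ | m
      · exact Or.inr (Or.inl hv)
      · rw [Function.iterate_succ_apply', theta_eq_zero_iff] at hv
        exact Or.inr (Or.inr ⟨m, le_rfl, hv⟩)

/-- In the tree rooted in `∞`, the vertices below level `l + 2` have preimages. -/
lemma exists_theta_eq_of_iterate_eq_infty [Finite F] {l t : ℕ}
    (hF : Nat.card F = 2 ^ (2 ^ l * (2 * t + 1))) {v : OnePoint F}
    (hv : theta^[l + 1] v = OnePoint.infty) : ∃ w, theta w = v := by
  rcases eq_of_iterate_theta_eq_infty hv with rfl | rfl | ⟨j, hj, h⟩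
  · exact ⟨_, theta_infty⟩
  · exact ⟨_, theta_eq_zero_iff.mpr rfl⟩
  · exact (exists_theta_eq_iff_of_iterate_eq_one hF h (by omega)).mpr (by omega)

/-- The tree rooted in `∞` has no vertices at level `l + 3`. -/
lemma iterate_theta_eq_infty [Finite F] {l t : ℕ}
    (hF : Nat.card F = 2 ^ (2 ^ l * (2 * t + 1))) {v : OnePoint F}
    (hv : theta^[l + 3] v = OnePoint.infty) :
    theta^[l + 2] v = OnePoint.infty := by
  have hfix (k : ℕ) : theta^[k] (OnePoint.infty : OnePoint F) = OnePoint.infty :=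
    Function.iterate_fixed theta_infty k
  rcases eq_of_iterate_theta_eq_infty hv with rfl | rfl | ⟨j, hj, h⟩
  · exact hfix _
  · rw [Function.iterate_succ_apply, theta_zero, hfix]
  · rcases Nat.lt_or_ge l j with hlj | hlj
    · obtain rfl : j = l + 1 := by omega
      rw [Function.iterate_succ_apply] at h
      exact absurd ((exists_theta_eq_iff_of_iterate_eq_one hF h le_rfl).mp ⟨v, rfl⟩) (lt_irrefl _)
    · obtain ⟨d, rfl⟩ := Nat.exists_eq_add_of_le hlj
      rw [show j + d + 2 = d + 1 + 1 + j by ring, Function.iterate_add_apply, h,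
        Function.iterate_succ_apply, theta_eq_zero_iff.mpr rfl, Function.iterate_succ_apply,
        theta_zero, hfix]

end Theta

/-! ### Iterating an endomorphism of a finite abelian group -/

section Endomorphism

variable {G : Type*} [AddCommGroup G] [Finite G] {f : G →+ G} {d : ℕ}

/-- If the kernels of the iterates of `f` do not grow after `d + 1`, then `f` is injective, hence a
permutation, on the range of `f^[d + 1]`. -/
lemma iterate_mem_periodicPts (hker : ∀ p, f^[d + 2] p = 0 → f^[d + 1] p = 0) (p : G) :
    f^[d + 1] p ∈ Function.periodicPts f := by
  have hmaps : Set.MapsTo f (Set.range f^[d + 1]) (Set.range f^[d + 1]) := by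
    rintro _ ⟨q, rfl⟩
    exact ⟨f q, by rw [← Function.iterate_succ_apply, Function.iterate_succ_apply']⟩
  have hinj : Set.InjOn f (Set.range f^[d + 1]) := by
    rintro _ ⟨q, rfl⟩ _ ⟨r, rfl⟩ h
    rw [← sub_eq_zero, ← iterate_map_sub]
    apply hker
    rw [← Function.iterate_succ_apply' f, ← Function.iterate_succ_apply' f] at h
    rw [iterate_map_sub, h, sub_self]
  have hinj' := hmaps.restrict_inj.mpr hinj
  obtain ⟨k, hk, h⟩ := (Function.Injective.mem_periodicPts hinj' ⟨f^[d + 1] p, p, rfl⟩)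
  refine ⟨k, hk, ?_⟩
  have := congrArg Subtype.val h
  rwa [hmaps.iterate_restrict] at this

lemma exists_eq_iff_iterate_mem_periodicPts (hker : ∀ p, f^[d + 2] p = 0 → f^[d + 1] p = 0)
    (hker' : ∀ p, f^[d] p = 0 → ∃ q, f q = p) (p : G) :
    (∃ q, f q = p) ↔ f^[d] p ∈ Function.periodicPts f := by
  constructor
  · rintro ⟨q, rfl⟩
    exact iterate_mem_periodicPts hker q
  · rintro ⟨k, hk, h⟩
    -- a periodic point lies in the range of every iterate, so `f^[d] p = f^[d] (f r)` for some `r`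
    have hmul : f^[k * (d + 1)] (f^[d] p) = f^[d] p := (h.mul_const (d + 1))
    obtain ⟨m, hm⟩ : ∃ m, k * (d + 1) = d + (m + 1) :=
      ⟨k * (d + 1) - (d + 1), by have := Nat.le_mul_of_pos_left (d + 1) hk; omega⟩
    rw [hm, Function.iterate_add_apply, Function.iterate_succ_apply'] at hmul
    obtain ⟨q, hq⟩ := hker' (p - f (f^[m] (f^[d] p))) (by rw [iterate_map_sub, hmul, sub_self])
    exact ⟨q + f^[m] (f^[d] p), by rw [map_add, hq, sub_add_cancel]⟩

end Endomorphism

/-! ### The Koblitz curve -/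

section Curve

/-- The Koblitz curve `y² + xy = x³ + 1`, with integral coefficients. -/
def koblitz : WeierstrassCurve ℤ := ⟨1, 0, 0, 0, 1⟩

variable {F : Type*} [Field F]

open WeierstrassCurve.Affine

/-- The `x`-coordinate of a point of the Koblitz curve, as a point of the projective line. -/
def xCoord : (koblitz⁄F).Point → OnePoint F
  | .zero => OnePoint.infty
  | .some x _ _ => OnePoint.some x

lemma equation_koblitz {x y : F} :
    (koblitz⁄F).Equation x y ↔ y ^ 2 + x * y = x ^ 3 + 1 := by
  rw [equation_iff]
  simp [koblitz]

lemma negY_koblitz {x y : F} : (koblitz⁄F).negY x y = -y - x := by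
  simp [negY, koblitz]

lemma xCoord_neg (P : (koblitz⁄F).Point) : xCoord (-P) = xCoord P := by
  rcases P with _ | ⟨x, y, h⟩ <;> rfl

lemma xCoord_eq_xCoord_iff {P Q : (koblitz⁄F).Point} : xCoord P = xCoord Q ↔ P = Q ∨ P = -Q := by
  constructor
  · intro h
    rcases P with _ | ⟨x₁, y₁, h₁⟩ <;> rcases Q with _ | ⟨x₂, y₂, h₂⟩
    · exact Or.inl rfl
    · simp [xCoord] at h
    · simp [xCoord] at h
    · exact Point.X_eq_iff.mp (OnePoint.coe_injective h)
  · rintro (rfl | rfl)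
    · rfl
    · exact xCoord_neg Q

lemma xCoord_eq_infty_iff {P : (koblitz⁄F).Point} : xCoord P = OnePoint.infty ↔ P = 0 := by
  rw [show (OnePoint.infty : OnePoint F) = xCoord (0 : (koblitz⁄F).Point) from rfl,
    xCoord_eq_xCoord_iff, Point.neg_zero, or_self]

variable [CharP F 2]

lemma nonsingular_koblitz {x y : F} :
    (koblitz⁄F).Nonsingular x y ↔ y ^ 2 + x * y = x ^ 3 + 1 := by
  rw [nonsingular_iff, equation_koblitz, and_iff_left_iff_imp]
  intro h
  rcases eq_or_ne x 0 with rfl | hx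
  · left
    have hy : y ≠ 0 := by
      rintro rfl
      simp at h
    simpa [koblitz] using hy
  · right
    simpa [koblitz, CharTwo.neg_eq, CharTwo.sub_eq_add] using hx

lemma mem_setA_iff_exists_xCoord [Finite F] {n : ℕ} (hn : 0 < n) (hF : Nat.card F = 2 ^ n)
    {v : OnePoint F} : v ∈ setA F n ↔ ∃ P : (koblitz⁄F).Point, xCoord P = v := by
  induction v using OnePoint.rec with
  | infty => exact iff_of_true (infty_mem_setA n) ⟨0, rfl⟩
  | coe a =>
    have h1 : (∃ P : (koblitz⁄F).Point, xCoord P = OnePoint.some a) ↔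
        ∃ y, y ^ 2 + a * y = a ^ 3 + 1 := by
      constructor
      · rintro ⟨_ | ⟨x, y, h⟩, hP⟩
        · simp [xCoord] at hP
        · obtain rfl : x = a := OnePoint.coe_injective hP
          exact ⟨y, nonsingular_koblitz.mp h⟩
      · rintro ⟨y, h⟩
        exact ⟨.some a y (nonsingular_koblitz.mpr h), rfl⟩
    rw [h1]
    rcases eq_or_ne a 0 with rfl | ha
    · exact iff_of_true (by simp [some_mem_setA_iff]) ⟨1, by simp⟩
    · rw [some_mem_setA_iff, ← absTrace_sq (a := a⁻¹) (pow_two_pow_card hF _),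
        ← CharTwo.add_eq_zero, ← absTrace_add, ← exists_sq_add_self_eq hn hF]
      -- the substitution `y = a u`
      constructor
      · rintro ⟨u, hu⟩
        refine ⟨a * u, ?_⟩
        have h2 : a ^ 2 * (u ^ 2 + u) = a ^ 2 * (a + a⁻¹ ^ 2) := by rw [hu]
        have h3 : a ^ 2 * a⁻¹ ^ 2 = 1 := by field_simp
        linear_combination h2 + h3
      · rintro ⟨y, hy⟩
        refine ⟨y / a, ?_⟩
        field_simp
        linear_combination hy

variable [DecidableEq F]

lemma xCoord_add_self_some {x y : F} (hx : x ≠ 0) (h : (koblitz⁄F).Nonsingular x y) :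
    xCoord (Point.some x y h + Point.some x y h) = OnePoint.some ((x + x⁻¹) ^ 2) := by
  have heq := nonsingular_koblitz.mp h
  have hneg : (koblitz⁄F).negY x y = y + x := by
    rw [negY_koblitz, CharTwo.neg_eq, CharTwo.sub_eq_add]
  have hy : y ≠ (koblitz⁄F).negY x y := by
    rw [hneg]
    simpa using hx
  rw [Point.add_self_of_Y_ne hy]
  change OnePoint.some ((koblitz⁄F).addX x x _) = _
  rw [slope_of_Y_ne rfl hy, hneg]
  congr 1
  have h2 : (2 : F) = 0 := CharTwo.two_eq_zero
  have h3 : y - (y + x) = -x := by ring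
  simp only [addX, h3]
  simp [koblitz]
  field_simp
  linear_combination heq + (-x ^ 2 - 3 * x ^ 2 * y - 2 * x ^ 3 + 4 * x ^ 4) * h2

/-- The conjugate of the Frobenius endomorphism of the Koblitz curve: since the product of the two
is the multiplication by `2`, it is obtained from the doubling by undoing the Frobenius. -/
noncomputable def conjFrobenius [Finite F] : (koblitz⁄F).Point →+ (koblitz⁄F).Point :=
  (Point.map (W' := koblitz)
    (((frobeniusEquiv F 2).symm : F →+* F).toIntAlgHom)).comp (nsmulAddMonoidHom 2)

lemma xCoord_conjFrobenius [Finite F] (P : (koblitz⁄F).Point) :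
    xCoord (conjFrobenius P) = theta (xCoord P) := by
  have hmap (Q : (koblitz⁄F).Point) (g : F →+* F) :
      xCoord (Point.map (W' := koblitz) g.toIntAlgHom Q) = (xCoord Q).map g := by
    rcases Q with _ | ⟨x, y, h⟩ <;> rfl
  change xCoord (Point.map (W' := koblitz) _ (2 • P)) = _
  rw [hmap, two_nsmul]
  rcases P with _ | ⟨x, y, h⟩
  · change OnePoint.map _ (xCoord (0 + 0)) = theta (xCoord 0)
    rw [add_zero]
    rfl
  · rcases eq_or_ne x 0 with rfl | hx
    · have hy : y = (koblitz⁄F).negY 0 y := by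
        rw [negY_koblitz, CharTwo.neg_eq, sub_zero]
      rw [Point.add_self_of_Y_eq hy]
      exact theta_zero.symm
    · rw [xCoord_add_self_some hx h]
      change _ = theta (OnePoint.some x)
      rw [theta_some hx, OnePoint.map_some]
      congr 1
      exact (frobeniusEquiv F 2).symm_apply_apply (x + x⁻¹)

end Curve

/-! ### The orbits in `A_n` -/

section Orbits

open WeierstrassCurve.Affine

variable {F : Type*} [Field F] [Finite F]

lemma mem_periodicPts_xCoord_iff [CharP F 2] [DecidableEq F] {P : (koblitz⁄F).Point} :
    xCoord P ∈ Function.periodicPts theta ↔ P ∈ Function.periodicPts conjFrobenius := by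
  have hsemi : Function.Semiconj xCoord (conjFrobenius (F := F)) theta := xCoord_conjFrobenius
  constructor
  · rintro ⟨k, hk, h⟩
    have h1 : xCoord (conjFrobenius^[k] P) = xCoord P := (hsemi.iterate_right k P).trans h
    rcases xCoord_eq_xCoord_iff.mp h1 with h2 | h2
    · exact ⟨k, hk, h2⟩
    · refine ⟨k + k, by omega, ?_⟩
      change conjFrobenius^[k + k] P = P
      rw [Function.iterate_add_apply, h2, iterate_map_neg, h2, neg_neg]
  · rintro ⟨k, hk, h⟩
    exact ⟨k, hk, (hsemi.iterate_right k P).symm.trans (congrArg xCoord h)⟩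

lemma finite_point [CharP F 2] : Finite (koblitz⁄F).Point := by
  refine Finite.of_injective (β := Option (F × F))
    (fun P => match P with
      | .zero => none
      | .some x y _ => Option.some (x, y)) ?_
  rintro (_ | ⟨x, y, h⟩) (_ | ⟨x', y', h'⟩) hPQ
  · rfl
  · simp at hPQ
  · simp at hPQ
  · simp only [Option.some.injEq, Prod.mk.injEq] at hPQ
    obtain ⟨rfl, rfl⟩ := hPQ
    rfl

variable [CharP F 2] {l t : ℕ}

lemma iterate_conjFrobenius_eq_zero_iff [DecidableEq F] {P : (koblitz⁄F).Point} {k : ℕ} :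
    conjFrobenius^[k] P = 0 ↔ theta^[k] (xCoord P) = OnePoint.infty := by
  have hsemi : Function.Semiconj xCoord (conjFrobenius (F := F)) theta := xCoord_conjFrobenius
  rw [← xCoord_eq_infty_iff, hsemi.iterate_right k P]

lemma iterate_conjFrobenius_eq_zero [DecidableEq F]
    (hF : Nat.card F = 2 ^ (2 ^ l * (2 * t + 1))) (P : (koblitz⁄F).Point)
    (hP : conjFrobenius^[l + 3] P = 0) : conjFrobenius^[l + 2] P = 0 := by
  rw [iterate_conjFrobenius_eq_zero_iff] at hP ⊢
  exact iterate_theta_eq_infty hF hP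

lemma exists_conjFrobenius_eq_iff [DecidableEq F]
    (hF : Nat.card F = 2 ^ (2 ^ l * (2 * t + 1))) {P : (koblitz⁄F).Point} :
    (∃ Q, conjFrobenius Q = P) ↔ ∃ w, theta w = xCoord P := by
  constructor
  · rintro ⟨Q, rfl⟩
    exact ⟨xCoord Q, (xCoord_conjFrobenius Q).symm⟩
  · rintro ⟨w, hw⟩
    have hn : 0 < 2 ^ l * (2 * t + 1) := by positivity
    have hmem : w ∈ setA F _ := mem_setA_of_theta_mem hn hF (by
      rw [hw]
      exact (mem_setA_iff_exists_xCoord hn hF).mpr ⟨P, rfl⟩)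
    obtain ⟨Q, rfl⟩ := (mem_setA_iff_exists_xCoord hn hF).mp hmem
    rw [← xCoord_conjFrobenius, xCoord_eq_xCoord_iff] at hw
    rcases hw with hw | hw
    · exact ⟨Q, hw⟩
    · exact ⟨-Q, by rw [map_neg, hw, neg_neg]⟩

theorem iterate_theta_mem_periodicPts (hF : Nat.card F = 2 ^ (2 ^ l * (2 * t + 1)))
    {v : OnePoint F} (hv : v ∈ setA F (2 ^ l * (2 * t + 1))) :
    theta^[l + 2] v ∈ Function.periodicPts theta := by
  classical
  have := finite_point (F := F)
  obtain ⟨P, rfl⟩ := (mem_setA_iff_exists_xCoord (by positivity) hF).mp hv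
  have hsemi : Function.Semiconj xCoord (conjFrobenius (F := F)) theta := xCoord_conjFrobenius
  rw [← hsemi.iterate_right, mem_periodicPts_xCoord_iff]
  exact iterate_mem_periodicPts (iterate_conjFrobenius_eq_zero hF) P

/-- The leaves of the trees in `A_n` are the vertices at level `l + 2`. -/
theorem exists_theta_eq_iff_iterate_mem_periodicPts
    (hF : Nat.card F = 2 ^ (2 ^ l * (2 * t + 1)))
    {v : OnePoint F} (hv : v ∈ setA F (2 ^ l * (2 * t + 1))) :
    (∃ w, theta w = v) ↔ theta^[l + 1] v ∈ Function.periodicPts theta := by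
  classical
  have := finite_point (F := F)
  obtain ⟨P, rfl⟩ := (mem_setA_iff_exists_xCoord (by positivity) hF).mp hv
  have hsemi : Function.Semiconj xCoord (conjFrobenius (F := F)) theta := xCoord_conjFrobenius
  rw [← hsemi.iterate_right, mem_periodicPts_xCoord_iff, ← exists_conjFrobenius_eq_iff hF]
  refine exists_eq_iff_iterate_mem_periodicPts (iterate_conjFrobenius_eq_zero hF) (fun Q hQ => ?_) P
  rw [exists_conjFrobenius_eq_iff hF]
  exact exists_theta_eq_of_iterate_eq_infty hF (iterate_conjFrobenius_eq_zero_iff.mp hQ)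

end Orbits

/-! ### The exponent `e₀` -/

section Exponent

open QuadraticAlgebra

lemma star_pi2 : star pi2 = -(omega : R) := by
  ext <;> simp [pi2]

lemma omega_dvd_iff {z : R} : (omega : R) ∣ z ↔ Even z.re := by
  constructor
  · rintro ⟨c, rfl⟩
    simp
  · rintro ⟨c, hc⟩
    exact ⟨⟨z.im + c, -c⟩, by ext <;> simp [hc]; ring⟩

lemma omega_mul_cancel {a b : R} (h : (omega : R) * a = omega * b) : a = b := by
  have h1 := congrArg QuadraticAlgebra.re h
  have h2 := congrArg QuadraticAlgebra.im h
  simp at h1 h2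
  ext
  · linarith
  · exact h1

lemma omega_pow_mul_cancel {k : ℕ} {a b : R} (h : (omega : R) ^ k * a = omega ^ k * b) :
    a = b := by
  induction k with
  | zero => simpa using h
  | succ k ih =>
    refine ih (omega_mul_cancel ?_)
    rw [← mul_assoc, ← mul_assoc, ← pow_succ']
    exact h

lemma pi2_mul_omega : pi2 * omega = (-2 : R) := by
  ext <;> simp [pi2]

/-- Squaring raises the exponent of `ω` in `x - 1` by exactly one as soon as that exponent is at
least two, because `2 = -π₂ ω` and `π₂` is a unit modulo `ω`. -/
lemma pi2_pow_two_pow (l : ℕ) :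
    ∃ u : R, pi2 ^ 2 ^ l = 1 + omega ^ (l + 2) * u ∧ Odd u.re := by
  induction l with
  | zero => exact ⟨1, by ext <;> simp [pi2, sq], by simp⟩
  | succ l ih =>
    obtain ⟨u, hu, hodd⟩ := ih
    refine ⟨-pi2 * u + omega ^ (l + 1) * u ^ 2, ?_, ?_⟩
    · rw [pow_succ, pow_mul, hu]
      linear_combination (omega ^ (l + 2) * u) * pi2_mul_omega
    · have h1 : Odd (-pi2 * u).re := by
        obtain ⟨c, hc⟩ := hodd
        simp only [pi2, re_mul, re_neg, re_add, re_one, omega_re, im_neg, im_add, im_one, omega_im]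
        exact ⟨c + u.im, by rw [hc]; ring⟩
      have h2 : Even (omega ^ (l + 1) * u ^ 2 : R).re :=
        omega_dvd_iff.mp ⟨omega ^ l * u ^ 2, by ring⟩
      exact h1.add_even h2

lemma pow_odd_of_one_add_omega_pow_mul {k : ℕ} {u : R} (hu : Odd u.re) (t : ℕ) :
    ∃ v : R, (1 + omega ^ (k + 1) * u) ^ (2 * t + 1) = 1 + omega ^ (k + 1) * v ∧ Odd v.re := by
  induction t with
  | zero => exact ⟨u, by simp, hu⟩
  | succ t ih =>
    obtain ⟨v, hv, hodd⟩ := ih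
    refine ⟨v + (2 * u + omega ^ (k + 1) * u ^ 2) * (1 + omega ^ (k + 1) * v), ?_, ?_⟩
    · rw [show 2 * (t + 1) + 1 = (2 * t + 1) + 2 by ring, pow_add, hv]
      ring
    · refine hodd.add_even (omega_dvd_iff.mp (Dvd.dvd.mul_right ?_ _))
      exact ⟨-pi2 * u + omega ^ k * u ^ 2, by linear_combination u * pi2_mul_omega⟩

lemma e0_two_pow_mul_odd (l t : ℕ) : e0 (2 ^ l * (2 * t + 1)) = l + 2 := by
  obtain ⟨u, hu, hodd⟩ := pi2_pow_two_pow l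
  obtain ⟨v, hv, hvodd⟩ := pow_odd_of_one_add_omega_pow_mul (k := l + 1) hodd t
  have h : pi2 ^ (2 ^ l * (2 * t + 1)) - 1 = omega ^ (l + 2) * v := by
    rw [pow_mul, hu, hv]
    ring
  rw [e0, h, star_pi2]
  refine multiplicity_eq_of_dvd_of_not_dvd ?_ ?_
  · exact (pow_dvd_pow_of_dvd (neg_dvd.mpr dvd_rfl) _).mul_right v
  · intro hdvd
    obtain ⟨c, hc⟩ := (pow_dvd_pow_of_dvd ((dvd_neg (a := (omega : R))).mpr dvd_rfl) _).trans hdvd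
    have h1 : v = omega * c := by
      refine omega_pow_mul_cancel (k := l + 2) ?_
      rw [hc]
      ring
    exact Int.not_even_iff_odd.mpr hvodd (omega_dvd_iff.mp ⟨c, h1⟩)

lemma eq_two_pow_mul_odd {n l : ℕ} (h : 2 ^ l ∣ n) (h' : ¬ 2 ^ (l + 1) ∣ n) :
    ∃ t, n = 2 ^ l * (2 * t + 1) := by
  obtain ⟨m, rfl⟩ := h
  have hm : ¬ 2 ∣ m := fun ⟨c, hc⟩ => h' ⟨c, by rw [hc, pow_succ, mul_assoc]⟩
  exact ⟨m / 2, by congr 1; omega⟩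

end Exponent

/-! ### The shape of the trees -/

section Trees

open Function

variable {F : Type*} [Field F] {x v w : OnePoint F} {k : ℕ}

lemma mem_treeVertices_of_theta_mem (hw : w ∉ periodicPts theta) (h : theta w ∈ treeVertices x) :
    w ∈ treeVertices x :=
  Relation.ReflTransGen.head ⟨rfl, hw⟩ h

lemma mem_treeChildren_iff (hv : v ∈ treeVertices x) :
    w ∈ treeChildren x v ↔ theta w = v ∧ w ∉ periodicPts theta := by
  constructor
  · rintro ⟨-, -, h⟩
    exact h
  · rintro ⟨rfl, h⟩
    exact ⟨mem_treeVertices_of_theta_mem h hv, hv, rfl, h⟩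

lemma treeLevel_subset_treeVertices : treeLevel x k ⊆ treeVertices x := by
  rcases k with _ | k
  · rintro _ rfl
    exact Relation.ReflTransGen.refl
  · rintro w ⟨v, -, hw, -⟩
    exact hw

lemma mem_treeLevel_succ_iff :
    w ∈ treeLevel x (k + 1) ↔ theta w ∈ treeLevel x k ∧ w ∉ periodicPts theta := by
  constructor
  · rintro ⟨v, hv, -, -, rfl, h⟩
    exact ⟨hv, h⟩
  · rintro ⟨hv, h⟩
    have hv' := treeLevel_subset_treeVertices hv
    exact ⟨theta w, hv, mem_treeVertices_of_theta_mem h hv', hv', rfl, h⟩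

lemma iterate_mem_treeLevel {j : ℕ} (hw : w ∈ treeLevel x (k + j)) :
    theta^[j] w ∈ treeLevel x k := by
  induction j generalizing w with
  | zero => exact hw
  | succ j ih => exact ih (mem_treeLevel_succ_iff.mp hw).1

lemma iterate_eq_of_mem_treeLevel (hw : w ∈ treeLevel x k) : theta^[k] w = x :=
  iterate_mem_treeLevel (k := 0) (by rwa [zero_add])

lemma exists_mem_treeLevel (hv : v ∈ treeVertices x) : ∃ k, v ∈ treeLevel x k := by
  induction hv using Relation.ReflTransGen.head_induction_on with
  | refl => exact ⟨0, rfl⟩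
  | head h _ ih =>
    obtain ⟨k, hk⟩ := ih
    obtain ⟨rfl, hv⟩ := h
    exact ⟨k + 1, mem_treeLevel_succ_iff.mpr ⟨hk, hv⟩⟩

lemma ncard_treeLevel_succ [Finite F] {c : ℕ}
    (h : ∀ v ∈ treeLevel x k, (treeChildren x v).ncard = c) :
    (treeLevel x (k + 1)).ncard = (treeLevel x k).ncard * c := by
  classical
  have : Finite (OnePoint F) := inferInstanceAs (Finite (Option F))
  have := Fintype.ofFinite (OnePoint F)
  rw [Set.ncard_eq_toFinset_card', Set.ncard_eq_toFinset_card']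
  refine (Finset.card_eq_sum_card_fiberwise (f := theta) (t := (treeLevel x k).toFinset)
    fun w hw => ?_).trans ?_
  · simp only [Set.coe_toFinset] at hw ⊢
    exact (mem_treeLevel_succ_iff.mp hw).1
  · refine Finset.sum_const_nat fun v hv => ?_
    rw [Set.mem_toFinset] at hv
    rw [← h v hv, Set.ncard_eq_toFinset_card']
    congr 1
    ext w
    simp only [Finset.mem_filter, Set.mem_toFinset, mem_treeLevel_succ_iff,
      mem_treeChildren_iff (treeLevel_subset_treeVertices hv)]
    constructor
    · rintro ⟨⟨-, h1⟩, h2⟩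
      exact ⟨h2, h1⟩
    · rintro ⟨rfl, h1⟩
      exact ⟨⟨hv, h1⟩, rfl⟩

lemma ncard_treeLevel_zero : (treeLevel x 0).ncard = 1 :=
  Set.ncard_singleton x

lemma infty_mem_periodicPts : (OnePoint.infty : OnePoint F) ∈ periodicPts theta :=
  ⟨1, one_pos, theta_infty⟩

lemma zero_notMem_periodicPts : OnePoint.some (0 : F) ∉ periodicPts theta := by
  intro h
  have := (bijOn_periodicPts theta).injOn h infty_mem_periodicPts
    (theta_zero.trans theta_infty.symm)
  simp at this

lemma theta_mem_periodicPts (h : v ∈ periodicPts theta) : theta v ∈ periodicPts theta :=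
  (bijOn_periodicPts theta).mapsTo h

lemma iterate_theta_mem_periodicPts_of_mem (h : v ∈ periodicPts theta) :
    theta^[k] v ∈ periodicPts theta := by
  induction k with
  | zero => exact h
  | succ k ih => exact iterate_succ_apply' theta k v ▸ theta_mem_periodicPts ih

lemma treeChildren_infty :
    treeChildren (OnePoint.infty : OnePoint F) OnePoint.infty = {OnePoint.some 0} := by
  ext w
  rw [mem_treeChildren_iff Relation.ReflTransGen.refl, theta_eq_infty_iff, Set.mem_singleton_iff]
  constructor
  · rintro ⟨rfl | rfl, h⟩
    · exact absurd infty_mem_periodicPts h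
    · rfl
  · rintro rfl
    exact ⟨Or.inr rfl, zero_notMem_periodicPts⟩

section CharTwo

variable [CharP F 2]

lemma treeChildren_zero (h0 : OnePoint.some 0 ∈ treeVertices x) :
    treeChildren x (OnePoint.some (0 : F)) = {OnePoint.some 1} := by
  ext w
  rw [mem_treeChildren_iff h0, theta_eq_zero_iff, Set.mem_singleton_iff, and_iff_left_iff_imp]
  rintro rfl h
  have := theta_mem_periodicPts h
  rw [theta_eq_zero_iff.mpr rfl] at this
  exact zero_notMem_periodicPts this

lemma setOf_theta_eq_add_inv {a : F} (ha : a ≠ 0) :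
    {w | theta w = OnePoint.some (a + a⁻¹)} = {OnePoint.some a, OnePoint.some a⁻¹} := by
  ext w
  rw [Set.mem_ofPred_eq, theta_eq_some_iff]
  constructor
  · rintro ⟨b, hb, rfl, h⟩
    rcases (add_inv_eq_add_inv_iff hb ha).mp h with rfl | rfl
    · exact Or.inl rfl
    · exact Or.inr rfl
  · rintro (rfl | rfl)
    · exact ⟨a, ha, rfl, rfl⟩
    · exact ⟨a⁻¹, inv_ne_zero ha, rfl, by rw [inv_inv, add_comm]⟩

/-- A preimage `w` of a vertex other than `0` and `∞` comes with exactly one further preimage. -/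
lemma exists_setOf_theta_eq_pair (hv : theta w ≠ OnePoint.infty)
    (hv0 : theta w ≠ OnePoint.some 0) :
    ∃ w', w' ≠ w ∧ {u | theta u = theta w} = {w, w'} := by
  obtain ⟨b, hb⟩ := OnePoint.ne_infty_iff_exists.mp hv
  obtain ⟨a, ha, rfl, rfl⟩ := theta_eq_some_iff.mp hb.symm
  refine ⟨OnePoint.some a⁻¹, ?_, by rw [← hb]; exact setOf_theta_eq_add_inv ha⟩
  intro h
  have h1 : a⁻¹ = a := OnePoint.coe_injective h
  rw [h1, CharTwo.add_self_eq_zero] at hb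
  exact hv0 hb.symm

lemma encard_setOf_theta_eq_le (v : OnePoint F) : {w | theta w = v}.encard ≤ 2 := by
  by_cases h : ∃ w, theta w = v
  · obtain ⟨w, rfl⟩ := h
    by_cases h1 : theta w = OnePoint.infty
    · rw [h1, show {w : OnePoint F | theta w = OnePoint.infty} = {OnePoint.infty, OnePoint.some 0}
        from Set.ext fun _ => theta_eq_infty_iff]
      exact (Set.encard_insert_le _ _).trans (by rw [Set.encard_singleton, one_add_one_eq_two])
    by_cases h2 : theta w = OnePoint.some 0
    · rw [h2]
      simp only [theta_eq_zero_iff, Set.ofPred_eq_eq_singleton, Set.encard_singleton]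
      exact one_le_two
    · obtain ⟨w', -, h3⟩ := exists_setOf_theta_eq_pair h1 h2
      rw [h3]
      exact (Set.encard_insert_le _ _).trans (by rw [Set.encard_singleton, one_add_one_eq_two])
  · rw [Set.eq_empty_of_forall_notMem (s := {w | theta w = v}) fun w hw => h ⟨w, hw⟩]
    simp

/-- Of the two preimages of a periodic vertex other than `∞`, exactly one is periodic. -/
lemma ncard_treeChildren_root (hx : x ∈ periodicPts theta) (hx' : x ≠ OnePoint.infty) :
    (treeChildren x x).ncard = 1 := by
  obtain ⟨w, hw, rfl⟩ := (bijOn_periodicPts theta).surjOn hx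
  obtain ⟨w', hne, hpair⟩ := exists_setOf_theta_eq_pair hx'
    (fun h => zero_notMem_periodicPts (h ▸ hx))
  rw [Set.ncard_eq_one]
  refine ⟨w', ?_⟩
  have hw' : theta w' = theta w := (Set.ext_iff.mp hpair w').mpr (Or.inr rfl)
  ext u
  rw [mem_treeChildren_iff Relation.ReflTransGen.refl, Set.mem_singleton_iff]
  constructor
  · rintro ⟨h1, h2⟩
    rcases (Set.ext_iff.mp hpair u).mp h1 with rfl | h3
    · exact absurd hw h2
    · exact h3
  · rintro rfl
    exact ⟨hw', fun h => hne ((bijOn_periodicPts theta).injOn h hw hw')⟩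

lemma ncard_treeChildren_eq_two (hvS : v ∈ treeVertices x) (hv : v ∉ periodicPts theta)
    (hv0 : v ≠ OnePoint.some 0) (hpre : ∃ w, theta w = v) : (treeChildren x v).ncard = 2 := by
  obtain ⟨w, rfl⟩ := hpre
  obtain ⟨w', hne, hpair⟩ := exists_setOf_theta_eq_pair
    (fun h => hv (h ▸ infty_mem_periodicPts)) hv0
  rw [← Set.ncard_pair hne.symm, ← hpair]
  congr 1
  ext u
  rw [mem_treeChildren_iff hvS]
  exact and_iff_left_of_imp fun h1 h2 => hv (h1 ▸ theta_mem_periodicPts h2)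

lemma ncard_treeChildren_level_one (hv : v ∈ treeLevel (OnePoint.infty : OnePoint F) 1) :
    (treeChildren OnePoint.infty v).ncard = 1 := by
  have hvS := treeLevel_subset_treeVertices hv
  obtain ⟨h1, h2⟩ := mem_treeLevel_succ_iff.mp hv
  rcases theta_eq_infty_iff.mp h1 with rfl | rfl
  · exact absurd infty_mem_periodicPts h2
  · rw [treeChildren_zero hvS, Set.ncard_singleton]

variable [Finite F] {l t : ℕ}

lemma treeVertices_subset_setA {n : ℕ} (hn : 0 < n) (hF : Nat.card F = 2 ^ n)
    (hx : x ∈ setA F n) : treeVertices x ⊆ setA F n := by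
  intro v hv
  induction hv using Relation.ReflTransGen.head_induction_on with
  | refl => exact hx
  | head h _ ih => exact mem_setA_of_theta_mem hn hF (h.1 ▸ ih)

/-- The vertex `0`, which occurs only at level `1` of the tree rooted in `∞`, is the one inner
vertex other than the root that has a single child. -/
lemma ncard_treeChildren_of_mem_treeLevel (hF : Nat.card F = 2 ^ (2 ^ l * (2 * t + 1)))
    (hx : x ∈ periodicA F (2 ^ l * (2 * t + 1))) (hxk : x = OnePoint.infty → 2 ≤ k) (hk : 1 ≤ k)
    (hkl : k < l + 2) (hv : v ∈ treeLevel x k) : (treeChildren x v).ncard = 2 := by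
  have hvS := treeLevel_subset_treeVertices hv
  have hvA := treeVertices_subset_setA (by positivity) hF hx.1 hvS
  obtain ⟨k, rfl⟩ := Nat.exists_eq_add_of_le' hk
  refine ncard_treeChildren_eq_two hvS (mem_treeLevel_succ_iff.mp hv).2 ?_ ?_
  · rintro rfl
    have h1 := mem_treeLevel_succ_iff.mp hv
    rw [theta_zero] at h1
    have h2 := iterate_eq_of_mem_treeLevel h1.1
    rw [iterate_fixed theta_infty] at h2
    obtain ⟨k, rfl⟩ := Nat.exists_eq_add_of_le' (Nat.le_of_succ_le_succ (hxk h2.symm))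
    exact (mem_treeLevel_succ_iff.mp h1.1).2 infty_mem_periodicPts
  · rw [exists_theta_eq_iff_iterate_mem_periodicPts hF hvA]
    obtain ⟨d, hd⟩ := Nat.exists_eq_add_of_le' (Nat.le_of_lt_succ hkl)
    rw [hd, iterate_add_apply, iterate_eq_of_mem_treeLevel hv]
    exact iterate_theta_mem_periodicPts_of_mem hx.2

lemma le_of_mem_treeLevel (hF : Nat.card F = 2 ^ (2 ^ l * (2 * t + 1)))
    (hx : x ∈ periodicA F (2 ^ l * (2 * t + 1))) (hv : v ∈ treeLevel x k) : k ≤ l + 2 := by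
  by_contra! hlt
  obtain ⟨d, rfl⟩ := Nat.exists_eq_add_of_lt hlt
  have hvA := treeVertices_subset_setA (by positivity) hF hx.1 (treeLevel_subset_treeVertices hv)
  rw [show l + 2 + d + 1 = (d + 1) + (l + 2) by ring] at hv
  exact (mem_treeLevel_succ_iff.mp (iterate_mem_treeLevel hv)).2
    (iterate_theta_mem_periodicPts hF hvA)

lemma ncard_treeLevel_one (hx : x ∈ periodicPts theta) : (treeLevel x 1).ncard = 1 := by
  rw [ncard_treeLevel_succ (c := 1), ncard_treeLevel_zero]
  rintro v hv
  obtain rfl : v = x := hv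
  by_cases h : v = OnePoint.infty
  · rw [h, treeChildren_infty, Set.ncard_singleton]
  · exact ncard_treeChildren_root hx h

lemma ncard_treeLevel_of_ne_infty (hF : Nat.card F = 2 ^ (2 ^ l * (2 * t + 1)))
    (hx : x ∈ periodicA F (2 ^ l * (2 * t + 1))) (hx' : x ≠ OnePoint.infty) (hk : k ≤ l + 1) :
    (treeLevel x (k + 1)).ncard = 2 ^ k := by
  induction k with
  | zero => exact ncard_treeLevel_one hx.2
  | succ k ih =>
    rw [ncard_treeLevel_succ fun v => ncard_treeChildren_of_mem_treeLevel hF hx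
      (fun h => absurd h hx') (by omega) (by omega), ih (by omega), pow_succ]

lemma ncard_treeLevel_infty (hF : Nat.card F = 2 ^ (2 ^ l * (2 * t + 1))) (hk : k ≤ l) :
    (treeLevel (OnePoint.infty : OnePoint F) (k + 2)).ncard = 2 ^ k := by
  induction k with
  | zero =>
    rw [ncard_treeLevel_succ fun v => ncard_treeChildren_level_one,
      ncard_treeLevel_one infty_mem_periodicPts, mul_one, pow_zero]
  | succ k ih =>
    rw [ncard_treeLevel_succ fun v => ncard_treeChildren_of_mem_treeLevel hF
      ⟨infty_mem_setA _, infty_mem_periodicPts⟩ (by omega) (by omega) (by omega),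
      ih (by omega), pow_succ]

lemma isReversedBinaryTree_treeVertices (hF : Nat.card F = 2 ^ (2 ^ l * (2 * t + 1)))
    (hx : x ∈ periodicA F (2 ^ l * (2 * t + 1))) :
    IsReversedBinaryTree (treeGraph F) (treeVertices x) x (l + 2) where
  root_mem := Relation.ReflTransGen.refl
  root_out w _ h := h.2 hx.2
  unique_out v hv hne := by
    rcases hv.cases_head with rfl | ⟨c, hc, hcS⟩
    · exact absurd rfl hne
    · exact ⟨c, ⟨hcS, hc⟩, fun c' hc' => hc'.2.1.symm.trans hc.1⟩
  reaches_root v hv := exists_mem_treeLevel hv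
  binary v hv := by
    refine (Set.encard_le_encard fun w hw => ?_).trans (encard_setOf_theta_eq_le v)
    exact ((mem_treeChildren_iff hv).mp hw).1
  depth := by
    refine ⟨?_, fun k ⟨v, hv⟩ => le_of_mem_treeLevel hF hx hv⟩
    refine Set.nonempty_of_ncard_ne_zero (s := treeLevel x (l + 2)) ?_
    by_cases h : x = OnePoint.infty
    · rw [h, ncard_treeLevel_infty hF le_rfl]
      positivity
    · rw [ncard_treeLevel_of_ne_infty hF hx h le_rfl]
      positivity

end CharTwo

end Trees

lemma ceil_two_zpow (k : ℕ) (m : ℤ) (h : m = k) : ⌈(2 : ℚ) ^ m⌉ = ((2 ^ k : ℕ) : ℤ) := by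
  rw [h, zpow_natCast]
  exact_mod_cast Int.ceil_natCast (R := ℚ) (2 ^ k)

end KoblitzGraph

theorem mainTheorem1 {F : Type*} [Field F] (n : ℕ) (hn : 0 < n) (hF : Nat.card F = 2 ^ n) :
    (∀ x ∈ KoblitzGraph.periodicA F n,
      KoblitzGraph.treeVertices x ⊆ KoblitzGraph.setA F n ∧
      KoblitzGraph.IsReversedBinaryTree (KoblitzGraph.treeGraph F) (KoblitzGraph.treeVertices x) x
        (KoblitzGraph.e0 n) ∧
      (x ≠ OnePoint.infty →
        (∀ k ≤ KoblitzGraph.e0 n,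
          ((KoblitzGraph.treeLevel x k).ncard : ℤ) = ⌈(2 : ℚ) ^ ((k : ℤ) - 1)⌉) ∧
        (KoblitzGraph.treeChildren x x).ncard = 1 ∧
        (∀ k, 1 ≤ k → k < KoblitzGraph.e0 n →
          ∀ v ∈ KoblitzGraph.treeLevel x k, (KoblitzGraph.treeChildren x v).ncard = 2)) ∧
      (x = OnePoint.infty →
        (∀ k ≤ KoblitzGraph.e0 n,
          ((KoblitzGraph.treeLevel x k).ncard : ℤ) = ⌈(2 : ℚ) ^ ((k : ℤ) - 2)⌉) ∧
        (KoblitzGraph.treeChildren x x).ncard = 1 ∧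
        (∀ v ∈ KoblitzGraph.treeLevel x 1, (KoblitzGraph.treeChildren x v).ncard = 1) ∧
        (∀ k, 2 ≤ k → k < KoblitzGraph.e0 n →
          ∀ v ∈ KoblitzGraph.treeLevel x k, (KoblitzGraph.treeChildren x v).ncard = 2))) ∧
    (∀ l : ℕ, 2 ^ l ∣ n → ¬ 2 ^ (l + 1) ∣ n → KoblitzGraph.e0 n = l + 2) := by
  open KoblitzGraph in
  refine ⟨?_, fun l h h' => ?_⟩
  swap
  · obtain ⟨t, rfl⟩ := eq_two_pow_mul_odd h h'
    exact e0_two_pow_mul_odd l t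
  have : Finite F := Nat.finite_of_card_ne_zero (by rw [hF]; positivity)
  have := Fintype.ofFinite F
  have : CharP F 2 := charP_of_card_eq_prime_pow (f := n) (by rw [← Nat.card_eq_fintype_card, hF])
  obtain ⟨l, m, hm, rfl⟩ := Nat.exists_eq_two_pow_mul_odd hn.ne'
  obtain ⟨t, rfl⟩ := hm
  rw [e0_two_pow_mul_odd]
  intro x hx
  refine ⟨treeVertices_subset_setA hn hF hx.1, isReversedBinaryTree_treeVertices hF hx, ?_, ?_⟩
  · intro hx'
    refine ⟨fun k hk => ?_, ncard_treeChildren_root hx.2 hx', fun k hk hkl v =>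
      ncard_treeChildren_of_mem_treeLevel hF hx (fun h => absurd h hx') hk hkl⟩
    rcases k with _ | k
    · rw [ncard_treeLevel_zero]
      norm_num
    · rw [ncard_treeLevel_of_ne_infty hF hx hx' (by omega),
        ceil_two_zpow k _ (by push_cast; ring)]
  · rintro rfl
    refine ⟨fun k hk => ?_, by rw [treeChildren_infty, Set.ncard_singleton],
      fun v => ncard_treeChildren_level_one, fun k hk hkl v =>
      ncard_treeChildren_of_mem_treeLevel hF hx (fun _ => hk) (by omega) hkl⟩
    rcases k with _ | _ | k
    · rw [ncard_treeLevel_zero]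
      norm_num
    · rw [ncard_treeLevel_one hx.2]
      norm_num
    · rw [ncard_treeLevel_infty hF (by omega), ceil_two_zpow k _ (by push_cast; ring)]
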